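/- Let $(X,d)$ be a separable metric space, not necessarily complete, and let $m$ be a non-trivial Radon measure on $X$ (regarded as an outer measure) that is finite on bounded sets and doubling: for some $C_D\ge 1$, $m(B_{2r}(x))\le C_D\,m(B_r(x))$ for all $x\in X$, $r>0$, where $B_r(x)$ is the open ball. For $x,y\in X$ and $L\ge 1$ let $m^L_{x,y}=R^L_{x,y}\,m$, where $$R^L_{x,y}(z)=\Big(\frac{d(x,z)}{m(B_{d(x,z)}(x))}+\frac{d(y,z)}{m(B_{d(y,z)}(y))}\Big)\chi_{B_{Ld(x,y)}(x)\cup B_{Ld(x,y)}(y)}(z)$$ for $z\ne x,y$ and $R^L_{x,y}(x)=R^L_{x,y}(y)=0$. For $u:X\to\mathbb R$ put $\mathrm{lip}\,u(x)=\lim_{\varepsilon\to0}\sup_{z\in B_\varepsilon(x)\setminus\{x\}}\frac{|u(z)-u(x)|}{d(z,x)}$ (with $\sup\emptyset=0$). An $\varepsilon$-chain from $x$ to $y$ is a finite sequence $q_0=x,q_1,\dots,q_N=y$ with $d(q_i,q_{i+1})\le\varepsilon$ for all $i<N$. The chain width from $x$ to $y$ of a set $A\subseteq X$ is $$\mathrm{width}_{x,y}(A)=\lim_{\varepsilon\to0}\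 \inf\Big\{\sum_{i=0}^{N-1}\frac{\chi_A(q_i)+\chi_A(q_{i+1})}{2}\,d(q_i,q_{i+1}) : (q_i)_{i=0}^N\text{ an }\varepsilon\text{-chain from }x\text{ to }y\Big\}$$ (with $\inf\emptyset=+\infty$). A set $\Omega\subseteq X$ is a separating set between $x$ and $y$ if it is closed, $x$ lies in the interior of $\Omega$, and $y\notin\Omega$. The Minkowski content of $A\subseteq X$ with respect to a measure $\nu$ is $\nu^+(A)=\liminf_{r\to0^+}\nu(B_r(A)\setminus A)/r$, where $B_r(A)=\{z: d(z,A)<r\}$. Theorem. For fixed $x,y\in X$ the following conditions are quantitatively equivalent: (i) there exist $C>0$, $L\ge1$ such that $|u(x)-u(y)|\le C\int_X \mathrm{lip}\,u\,dm^L_{x,y}$ for every Lipschitz $u:X\to\mathbb R$; (ii) there exist $C>0$, $L\ge1$ such that $\mathrm{width}_{x,y}(A)\le C\,m^L_{x,y}(A)$ for every $A\subseteq X$; (iii) there exist $c>0$, $L\ge1$ such that $(m^L_{x,y})^+(\Omega)\ge c$ for every separating set $\Omega$ between $x$ and $y$. Here quantitatively equivalent means that if one of the conditions holds, then each of the others holds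 with constants that depend only on the constants in the first one and on $C_D$ (and not on the space, the measure or the points). -/

import Mathlib

open MeasureTheory Set Filter Topology
open scoped ENNReal NNReal

universe u

/-- A doubling metric measure space with doubling constant at most `C_D`: the metric space is
separable (not necessarily complete), the measure is non-trivial, Radon (`Measure.Regular`), finite
on bounded sets, and satisfies `m(B_{2r}(x)) ≤ C_D m(B_r(x))` for all balls. -/
structure IsDoublingMMS {X : Type u} [MetricSpace X] [MeasurableSpace X]
    (m : Measure X) (C_D : ℝ) : Prop where
  separable : TopologicalSpace.SeparableSpace X
  borel : BorelSpace X
  nontrivial : m ≠ 0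
  radon : m.Regular
  finite_on_bounded : ∀ s : Set X, Bornology.IsBounded s → m s < ∞
  doubling : ∀ (x : X) (r : ℝ), 0 < r →
    m (Metric.ball x (2 * r)) ≤ ENNReal.ofReal C_D * m (Metric.ball x r)

/-- The slope of `f` at size `ε`: the supremum of `|f z - f x| / d(z, x)` over `z ∈ B_ε(x)`
(the term `z = x` is `0 / 0 = 0` and does not contribute). -/
noncomputable def slopeAt {X : Type u} [MetricSpace X] (ε : ℝ) (f : X → ℝ) (x : X) : ℝ≥0∞ :=
  ⨆ z ∈ Metric.ball x ε, edist (f z) (f x) / edist z x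

/-- The local Lipschitz constant `lip f (x) = inf_{ε > 0} slope_ε f (x)`. -/
noncomputable def localLip {X : Type u} [MetricSpace X] (f : X → ℝ) (x : X) : ℝ≥0∞ :=
  ⨅ ε ∈ Ioi (0 : ℝ), slopeAt ε f x

/-- The local Lipschitz constant is the limit of the slopes as `ε → 0`. -/
theorem tendsto_slopeAt {X : Type u} [MetricSpace X] (f : X → ℝ) (x : X) :
    Tendsto (fun ε : ℝ => slopeAt ε f x) (𝓝[>] 0) (𝓝 (localLip f x)) := by
  have hmono : Monotone (fun ε : ℝ => slopeAt ε f x) := fun a b hab =>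
    biSup_mono fun _ hz => Metric.ball_subset_ball hab hz
  have h := hmono.tendsto_nhdsGT (0 : ℝ)
  rwa [sInf_image] at h

/-- The union of balls `B_{x,y}^L = B_{L d(x,y)}(x) ∪ B_{L d(x,y)}(y)`. -/
def twoPoleBall {X : Type u} [MetricSpace X] (L : ℝ) (x y : X) : Set X :=
  Metric.ball x (L * dist x y) ∪ Metric.ball y (L * dist x y)

open Classical in
/-- The `L`-truncated Riesz potential with poles `x`, `y`, set to be `0` at the poles. -/
noncomputable def rieszPotential {X : Type u} [MetricSpace X] [MeasurableSpace X]
    (m : Measure X) (L : ℝ) (x y z : X) : ℝ≥0∞ :=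
  if z ∈ twoPoleBall L x y ∧ z ≠ x ∧ z ≠ y then
    edist x z / m (Metric.ball x (dist x z)) + edist y z / m (Metric.ball y (dist y z))
  else 0

/-- The measure `m_{x,y}^L`, with density the truncated Riesz potential with respect to `m`. -/
noncomputable def rieszMeasure {X : Type u} [MetricSpace X] [MeasurableSpace X]
    (m : Measure X) (L : ℝ) (x y : X) : Measure X :=
  m.withDensity (rieszPotential m L x y)

/-- A chain: a finite sequence of points `q_0, …, q_N`. -/
structure PointChain (X : Type u) where
  N : ℕ
  pt : Fin (N + 1) → X

/-- The `ε`-chains from `x` to `y`: consecutive points have distance at most `ε`. -/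
def epsChains {X : Type u} [MetricSpace X] (ε : ℝ) (x y : X) : Set (PointChain X) :=
  {c | (∀ i : Fin c.N, dist (c.pt i.castSucc) (c.pt i.succ) ≤ ε) ∧
    c.pt 0 = x ∧ c.pt (Fin.last c.N) = y}

/-- The integral of `g` along a chain:
`∑_{i < N} (g (q_i) + g (q_{i+1})) / 2 * d(q_i, q_{i+1})`. -/
noncomputable def PointChain.integral {X : Type u} [MetricSpace X] (c : PointChain X)
    (g : X → ℝ≥0∞) : ℝ≥0∞ :=
  ∑ i : Fin c.N, (g (c.pt i.castSucc) + g (c.pt i.succ)) / 2 *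
    edist (c.pt i.castSucc) (c.pt i.succ)

/-- The infimum of `∫_c χ_A` over the `ε`-chains `c` from `x` to `y` (`∞` if there are none). -/
noncomputable def epsChainWidth {X : Type u} [MetricSpace X] (ε : ℝ) (x y : X) (A : Set X) :
    ℝ≥0∞ :=
  ⨅ c ∈ epsChains ε x y, c.integral (A.indicator fun _ => 1)

/-- The chain width `lim_{ε → 0} inf_c ∫_c χ_A`; as the infimum is non-increasing in `ε`, the limit
is the supremum over `ε > 0`. -/
noncomputable def chainWidth {X : Type u} [MetricSpace X] (x y : X) (A : Set X) : ℝ≥0∞ :=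
  ⨆ ε ∈ Ioi (0 : ℝ), epsChainWidth ε x y A

/-- The chain width is the limit of the infima over `ε`-chains as `ε → 0`. -/
theorem tendsto_epsChainWidth {X : Type u} [MetricSpace X] (x y : X) (A : Set X) :
    Tendsto (fun ε : ℝ => epsChainWidth ε x y A) (𝓝[>] 0) (𝓝 (chainWidth x y A)) := by
  have hanti : Antitone (fun ε : ℝ => epsChainWidth ε x y A) := fun a b hab =>
    biInf_mono fun _ hc => ⟨fun i => (hc.1 i).trans hab, hc.2⟩
  have h := Monotone.tendsto_nhdsGT (β := ℝ≥0∞ᵒᵈ) hanti.dual_right (0 : ℝ)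
  rw [sInf_image] at h
  exact h

/-- `Ω` is a (topological) separating set between `x` and `y`. -/
def IsSeparatingSet {X : Type u} [MetricSpace X] (x y : X) (Ω : Set X) : Prop :=
  IsClosed Ω ∧ x ∈ interior Ω ∧ y ∈ Ωᶜ

/-- The (lower, outer) Minkowski content `liminf_{r → 0} ν(B_r(A) \ A) / r`. -/
noncomputable def minkowskiContent {X : Type u} [MetricSpace X] [MeasurableSpace X]
    (ν : Measure X) (A : Set X) : ℝ≥0∞ :=
  liminf (fun r : ℝ => ν (Metric.thickening r A \ A) / ENNReal.ofReal r) (𝓝[>] 0)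

/-- A property of two points of a metric measure space that involves two real constants. -/
abbrev TwoPointCondition : Type (u + 1) :=
  ∀ (X : Type u) [MetricSpace X] [MeasurableSpace X], Measure X → X → X → ℝ → ℝ → Prop

/-- The pointwise `1`-Poincaré estimate at `x`, `y` for Lipschitz functions, with constants
`C`, `L`. -/
def PointwisePoincare : TwoPointCondition.{u} := fun X _ _ m x y C L =>
  ∀ f : X → ℝ, (∃ K : ℝ≥0, LipschitzWith K f) →
    ENNReal.ofReal |f x - f y| ≤ ENNReal.ofReal C * ∫⁻ z, localLip f z ∂(rieszMeasure m L x y)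

/-- The chain width from `x` to `y` of every set is at most `C` times its measure. -/
def ChainWidthBound : TwoPointCondition.{u} := fun X _ _ m x y C L =>
  ∀ A : Set X, chainWidth x y A ≤ ENNReal.ofReal C * rieszMeasure m L x y A

/-- All separating sets between `x` and `y` have Minkowski content at least `c`. -/
def BigMinkowskiContent : TwoPointCondition.{u} := fun X _ _ m x y c L =>
  ∀ Ω : Set X, IsSeparatingSet x y Ω →
    ENNReal.ofReal c ≤ minkowskiContent (rieszMeasure m L x y) Ω

/-- `P` quantitatively implies `Q` in doubling metric measure spaces: if `P` holds at `x`, `y` with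
constants `C > 0`, `L ≥ 1`, then `Q` holds at `x`, `y` with constants `C' > 0`, `L' ≥ 1` that depend
only on `C`, `L` and the doubling constant. -/
def QuantImplies (P Q : TwoPointCondition.{u}) : Prop :=
  ∀ C_D C L : ℝ, 1 ≤ C_D → 0 < C → 1 ≤ L →
    ∃ C' L' : ℝ, 0 < C' ∧ 1 ≤ L' ∧
      ∀ (X : Type u) [MetricSpace X] [MeasurableSpace X] (m : Measure X),
        IsDoublingMMS m C_D → ∀ x y : X, P X m x y C L → Q X m x y C' L'

/-- Quantitative equivalence: quantitative implication in both directions. -/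
def QuantEquiv (P Q : TwoPointCondition.{u}) : Prop :=
  QuantImplies P Q ∧ QuantImplies Q P

/-! The conditions are proved in the cycle (i) ⇒ (ii) ⇒ (iii) ⇒ (i), keeping `L` fixed throughout;
doubling enters only through the finiteness of the Riesz measure.

(i) ⇒ (ii). For `U` open, the `ε`-chain width of `U` from `x` to a variable endpoint, truncated at a
finite height, is 1-Lipschitz at scale `ε` and does not change along short steps outside `U`.
`exists_lipschitz_flattening` replaces it by a nearby Lipschitz function with local Lipschitz
constant at most 4 on `U` and 0 off `U`; the Poincaré estimate then bounds the width by `4 * C`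
times the measure of `U`. Outer regularity extends this to all sets.

(ii) ⇒ (iii). Along a fine chain from `x` to `y`, the truncated distance to `Ω` rises from 0 to `r`,
and it can rise only on steps meeting the collar of width `r`. So the collar has width at least `r /
2`.

(iii) ⇒ (i). Sublevel sets at levels between `f x` and `f y` are separating. A coarea inequality,
from Fubini at scale `r` and Fatou as `r → 0`, bounds the integral of their Minkowski contents by
that of `localLip f`. -/

theorem abs_min_sub_min_le_abs (a b c : ℝ) : |min a c - min b c| ≤ |a - b| :=
  (abs_min_sub_min_le_max a c b c).trans (by simp)

/-! ### Finiteness of the Riesz measure. -/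

section Finiteness

variable {X : Type u} [MetricSpace X] [MeasurableSpace X] {m : Measure X} {C_D : ℝ}

/-- A null ball would make all its dyadic enlargements null by doubling, and they exhaust the space.
-/
theorem IsDoublingMMS.measure_ball_pos (h : IsDoublingMMS m C_D) (x : X) {r : ℝ} (hr : 0 < r) :
    0 < m (Metric.ball x r) := by
  rw [pos_iff_ne_zero]
  intro h0
  apply h.nontrivial
  have key : ∀ k : ℕ, m (Metric.ball x (2 ^ k * r)) = 0 := by
    intro k
    induction k with
    | zero => simpa using h0
    | succ k ih =>
      have := h.doubling x (2 ^ k * r) (by positivity)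
      rw [ih, mul_zero, ← mul_assoc, ← pow_succ'] at this
      exact le_antisymm this zero_le
  rw [← Measure.measure_univ_eq_zero]
  have hcov : (univ : Set X) ⊆ ⋃ k : ℕ, Metric.ball x (2 ^ k * r) := by
    intro z _
    obtain ⟨k, hk⟩ := pow_unbounded_of_one_lt (dist z x / r) (one_lt_two)
    exact mem_iUnion.2 ⟨k, Metric.mem_ball.2 ((div_lt_iff₀ hr).1 hk)⟩
  exact measure_mono_null hcov (measure_iUnion_null key)

/-- The Riesz kernel with one pole is integrable on balls centred at the pole. -/
theorem IsDoublingMMS.lintegral_kernel_lt_top (h : IsDoublingMMS m C_D) (x : X) {R : ℝ}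
    (hR : 0 < R) :
    ∫⁻ z, (Metric.ball x R).indicator
      (fun z => edist x z / m (Metric.ball x (dist x z))) z ∂m < ∞ := by
  have := h.borel
  -- An upper bound for the kernel on the `k`-th dyadic annulus; by doubling it contributes at most
  -- a multiple of `2⁻ᵏ`.
  set a : ℕ → ℝ≥0∞ := fun k =>
    ENNReal.ofReal ((1 / 2) ^ k * R) / m (Metric.ball x ((1 / 2) ^ (k + 1) * R)) with ha
  have hpt : ∀ z, (Metric.ball x R).indicator
      (fun z => edist x z / m (Metric.ball x (dist x z))) z ≤
      ∑' k : ℕ, (Metric.ball x ((1 / 2) ^ k * R)).indicator (fun _ => a k) z := by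
    intro z
    by_cases hz : z ∈ Metric.ball x R
    swap
    · simp [hz]
    rw [indicator_of_mem hz]
    rcases eq_or_ne x z with rfl | hne
    · simp
    have hd : 0 < dist x z := dist_pos.2 hne
    have hzR : dist x z < R := by rwa [Metric.mem_ball'] at hz
    obtain ⟨k, hk1, hk2⟩ := exists_nat_pow_near_of_lt_one (x := dist x z / R) (y := (1 / 2 : ℝ))
      (by positivity) ((div_le_one hR).2 hzR.le) (by norm_num) (by norm_num)
    rw [lt_div_iff₀ hR] at hk1
    rw [div_le_iff₀ hR] at hk2
    rcases hk2.lt_or_eq with hk2 | hk2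
    · refine le_trans ?_ (ENNReal.le_tsum k)
      rw [indicator_of_mem (Metric.mem_ball'.2 hk2), ha, edist_dist]
      simp only
      gcongr
    -- At the exact radius the point misses the open ball of index `k`, so the next larger ball is
    -- used.
    · rcases k with _ | k
      · simp at hk2; exact absurd hk2 hzR.ne
      refine le_trans ?_ (ENNReal.le_tsum k)
      have hlt : dist x z < (1 / 2) ^ k * R := by
        rw [hk2, pow_succ]
        have : 0 < (1 / 2 : ℝ) ^ k * R := by positivity
        linarith
      rw [indicator_of_mem (Metric.mem_ball'.2 hlt), ha, edist_dist]
      have h2 := hk2.ge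
      simp only
      gcongr
  refine (lintegral_mono hpt).trans_lt ?_
  rw [lintegral_tsum fun k => (measurable_const.indicator Metric.isOpen_ball.measurableSet).aemeasurable]
  have hterm : ∀ k : ℕ, ∫⁻ z, (Metric.ball x ((1 / 2) ^ k * R)).indicator (fun _ => a k) z ∂m ≤
      ENNReal.ofReal (C_D * R * (1 / 2) ^ k) := by
    intro k
    have hr : 0 < (1 / 2 : ℝ) ^ (k + 1) * R := by positivity
    rw [lintegral_indicator_const Metric.isOpen_ball.measurableSet]
    have hdb := h.doubling x _ hr
    have he : 2 * ((1 / 2 : ℝ) ^ (k + 1) * R) = (1 / 2) ^ k * R := by rw [pow_succ]; ring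
    rw [he] at hdb
    calc a k * m (Metric.ball x ((1 / 2) ^ k * R))
        ≤ a k * (ENNReal.ofReal C_D * m (Metric.ball x ((1 / 2) ^ (k + 1) * R))) := by gcongr
      _ = ENNReal.ofReal C_D * (ENNReal.ofReal ((1 / 2) ^ k * R) /
            m (Metric.ball x ((1 / 2) ^ (k + 1) * R)) *
            m (Metric.ball x ((1 / 2) ^ (k + 1) * R))) := by rw [ha]; ring
      _ = ENNReal.ofReal C_D * ENNReal.ofReal ((1 / 2) ^ k * R) := by
          rw [ENNReal.div_mul_cancel (h.measure_ball_pos x hr).ne'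
            (h.finite_on_bounded _ Metric.isBounded_ball).ne]
      _ = ENNReal.ofReal (C_D * R * (1 / 2) ^ k) := by
          rw [← ENNReal.ofReal_mul' (by positivity)]; congr 1; ring
  refine (ENNReal.tsum_le_tsum hterm).trans_lt ?_
  exact ((summable_geometric_of_lt_one (by norm_num) (by norm_num)).mul_left _).tsum_ofReal_lt_top

/-- Finiteness gives outer regularity in (i) ⇒ (ii), and Fubini and dominated convergence in the
coarea inequality. -/
theorem IsDoublingMMS.isFiniteMeasure_rieszMeasure (h : IsDoublingMMS m C_D) (L : ℝ) (x y : X) :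
    IsFiniteMeasure (rieszMeasure m L x y) := by
  have := h.borel
  set R : ℝ := max 0 L * dist x y + dist x y + 1 with hR
  have hL : 0 ≤ max 0 L * dist x y := by positivity
  have hL' : L * dist x y ≤ max 0 L * dist x y := by gcongr; exact le_max_right _ _
  have hRpos : 0 < R := by positivity
  have hx := h.lintegral_kernel_lt_top x hRpos
  have hy := h.lintegral_kernel_lt_top y hRpos
  have hmeas : ∀ p : X, Measurable fun z => (Metric.ball p R).indicator
      (fun z => edist p z / m (Metric.ball p (dist p z))) z := by
    intro p
    refine Measurable.indicator ?_ Metric.isOpen_ball.measurableSet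
    have hmono : Monotone fun r : ℝ => m (Metric.ball p r) := fun a b hab =>
      measure_mono (Metric.ball_subset_ball hab)
    exact (continuous_const.edist continuous_id).measurable.div
      (hmono.measurable.comp (continuous_const.dist continuous_id).measurable)
  refine ⟨?_⟩
  rw [rieszMeasure, withDensity_apply _ MeasurableSet.univ, setLIntegral_univ]
  refine (lintegral_mono fun z => ?_).trans_lt
    ((lintegral_add_left (hmeas x) _).trans_lt (ENNReal.add_lt_top.2 ⟨hx, hy⟩))
  rw [rieszPotential]
  split_ifs with hz
  swap
  · exact zero_le
  have hz1 : z ∈ Metric.ball x R ∧ z ∈ Metric.ball y R := by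
    have h1 := dist_triangle z x y
    have h2 := dist_triangle z y x
    rw [dist_comm y x] at h2
    rcases hz.1 with hz | hz <;> rw [Metric.mem_ball] at hz <;>
      constructor <;> rw [Metric.mem_ball] <;> linarith [dist_nonneg (x := x) (y := y)]
  rw [indicator_of_mem hz1.1, indicator_of_mem hz1.2]

end Finiteness

/-! ### Slopes and local Lipschitz constants. -/

section LocalLip

variable {X : Type u} [MetricSpace X]

theorem slopeAt_le_of_forall {f : X → ℝ} {z : X} {s : ℝ} {K : ℝ≥0}
    (h : ∀ w, dist w z < s → dist (f w) (f z) ≤ K * dist w z) : slopeAt s f z ≤ K := by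
  refine iSup₂_le fun w hw => ENNReal.div_le_of_le_mul ?_
  rw [edist_dist, edist_dist, ← ENNReal.ofReal_coe_nnreal, ← ENNReal.ofReal_mul K.coe_nonneg]
  exact ENNReal.ofReal_le_ofReal (h w hw)

theorem localLip_le_of_forall {f : X → ℝ} {z : X} {s : ℝ} (hs : 0 < s) {K : ℝ≥0}
    (h : ∀ w, dist w z < s → dist (f w) (f z) ≤ K * dist w z) : localLip f z ≤ K :=
  (iInf₂_le s hs).trans (slopeAt_le_of_forall h)

theorem dist_le_slopeAt_mul {f : X → ℝ} {z w : X} {s : ℝ} (hw : dist w z < s) :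
    edist (f w) (f z) ≤ slopeAt s f z * edist w z := by
  rcases eq_or_ne w z with rfl | hne
  · simp
  · rw [← ENNReal.div_le_iff (edist_pos.2 hne).ne' (edist_ne_top _ _)]
    exact le_iSup₂ (f := fun w (_ : w ∈ Metric.ball z s) => edist (f w) (f z) / edist w z) w hw

/-- A competitor `w` for the supremum at `z` stays in the open ball around nearby points, and its
quotient varies continuously. This supplies measurability of the slopes. -/
theorem lowerSemicontinuous_slopeAt {f : X → ℝ} (hf : Continuous f) (s : ℝ) :
    LowerSemicontinuous (slopeAt s f) := by
  intro z a ha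
  obtain ⟨w, hw, hlt⟩ : ∃ w ∈ Metric.ball z s, a < edist (f w) (f z) / edist w z := by
    simpa only [slopeAt, lt_iSup_iff, exists_prop] using ha
  have hne : w ≠ z := by
    rintro rfl
    simp at hlt
  have hcont : Tendsto (fun z' => edist (f w) (f z') / edist w z') (𝓝 z)
      (𝓝 (edist (f w) (f z) / edist w z)) :=
    ENNReal.Tendsto.div ((continuous_const.edist hf).tendsto z) (Or.inr (edist_pos.2 hne).ne')
      ((continuous_const.edist continuous_id).tendsto z) (Or.inr (edist_ne_top _ _))
  have hball : ∀ᶠ z' in 𝓝 z, dist w z' < s :=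
    (continuous_const.dist continuous_id).continuousAt.eventually_lt continuousAt_const hw
  filter_upwards [hcont.eventually_const_lt hlt, hball] with z' h1 h2
  exact h1.trans_le
    (le_iSup₂ (f := fun w (_ : w ∈ Metric.ball z' s) => edist (f w) (f z') / edist w z') w h2)

end LocalLip

/-! ### Chain width as a function of the endpoint. -/

section ChainPotential

variable {X : Type u} [MetricSpace X]

/-- Telescoping along a chain. -/
theorem PointChain.ofReal_sub_le_integral (c : PointChain X) (h : X → ℝ) (g : X → ℝ≥0∞)
    (hstep : ∀ i : Fin c.N, ENNReal.ofReal (h (c.pt i.succ) - h (c.pt i.castSucc)) ≤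
      2 * ((g (c.pt i.castSucc) + g (c.pt i.succ)) / 2 *
        edist (c.pt i.castSucc) (c.pt i.succ))) :
    ENNReal.ofReal (h (c.pt (Fin.last c.N)) - h (c.pt 0)) ≤ 2 * c.integral g := by
  have htel : h (c.pt (Fin.last c.N)) - h (c.pt 0) =
      ∑ i : Fin c.N, (h (c.pt i.succ) - h (c.pt i.castSucc)) := by
    rw [Finset.sum_sub_distrib]
    have h1 := Fin.sum_univ_succ fun i => h (c.pt i)
    have h2 := Fin.sum_univ_castSucc fun i => h (c.pt i)
    linarith
  rw [htel, PointChain.integral, Finset.mul_sum]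
  refine (Finset.le_sum_of_subadditive _ ENNReal.ofReal_zero.le
    (fun _ _ => ENNReal.ofReal_add_le) _ _).trans (Finset.sum_le_sum fun i _ => hstep i)

theorem epsChainWidth_mono (ε : ℝ) (x y : X) {A B : Set X} (h : A ⊆ B) :
    epsChainWidth ε x y A ≤ epsChainWidth ε x y B := by
  refine iInf₂_mono fun c _ => Finset.sum_le_sum fun i _ => ?_
  gcongr

theorem epsChainWidth_self (ε : ℝ) (x : X) (A : Set X) : epsChainWidth ε x x A = 0 := by
  refine le_antisymm ?_ zero_le
  refine (iInf₂_le (⟨0, fun _ => x⟩ : PointChain X) ⟨fun i => i.elim0, rfl, rfl⟩).trans ?_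
  simp [PointChain.integral]

/-- Append `w` to any chain ending at `z`. -/
theorem epsChainWidth_le_add {ε : ℝ} {x z w : X} (A : Set X) (h : dist z w ≤ ε) :
    epsChainWidth ε x w A ≤ epsChainWidth ε x z A +
      (A.indicator (fun _ => 1) z + A.indicator (fun _ => 1) w) / 2 * edist z w := by
  conv_rhs => rw [epsChainWidth]
  simp only [ENNReal.iInf_add]
  refine le_iInf₂ fun c hc => ?_
  obtain ⟨hstep, h0, hlast⟩ := hc
  refine (iInf₂_le (⟨c.N + 1, Fin.snoc (α := fun _ => X) c.pt w⟩ : PointChain X)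
    ⟨?_, ?_, ?_⟩).trans ?_
  · simp only [PointChain.integral]
    rw [Fin.sum_univ_castSucc]
    simp only [Fin.succ_castSucc, Fin.snoc_castSucc, Fin.succ_last, Fin.snoc_last, hlast]
    exact le_rfl
  · intro i
    refine Fin.lastCases ?_ (fun j => ?_) i
    · have h1 : Fin.snoc (α := fun _ => X) c.pt w (Fin.last c.N).castSucc = z := by
        rw [Fin.snoc_castSucc, hlast]
      have h2 : Fin.snoc (α := fun _ => X) c.pt w (Fin.last c.N).succ = w := by
        rw [Fin.succ_last, Fin.snoc_last]
      simpa only [h1, h2] using h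
    · have h1 : Fin.snoc (α := fun _ => X) c.pt w j.castSucc.castSucc = c.pt j.castSucc := by
        rw [Fin.snoc_castSucc]
      have h2 : Fin.snoc (α := fun _ => X) c.pt w j.castSucc.succ = c.pt j.succ := by
        rw [Fin.succ_castSucc, Fin.snoc_castSucc]
      simpa only [h1, h2] using hstep j
  · change Fin.snoc (α := fun _ => X) c.pt w (Fin.castSucc 0) = x
    rw [Fin.snoc_castSucc, h0]
  · exact Fin.snoc_last (α := fun _ => X) _ _

/-- The chain width from `x`, truncated at height `M`, as a real function of the endpoint. -/
noncomputable def chainPotential (ε : ℝ) (x : X) (A : Set X) (M : ℝ≥0) (z : X) : ℝ :=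
  (min (epsChainWidth ε x z A) M).toReal

variable {ε : ℝ} {x : X} {A : Set X} {M : ℝ≥0}

theorem ofReal_chainPotential (z : X) :
    ENNReal.ofReal (chainPotential ε x A M z) = min (epsChainWidth ε x z A) M :=
  ENNReal.ofReal_toReal (min_lt_of_right_lt ENNReal.coe_lt_top).ne

theorem chainPotential_nonneg (z : X) : 0 ≤ chainPotential ε x A M z := ENNReal.toReal_nonneg

theorem chainPotential_le (z : X) : chainPotential ε x A M z ≤ M := by
  have := ENNReal.toReal_mono ENNReal.coe_ne_top
    (min_le_right (epsChainWidth ε x z A) (M : ℝ≥0∞))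
  simpa [chainPotential] using this

theorem chainPotential_self : chainPotential ε x A M x = 0 := by
  simp [chainPotential, epsChainWidth_self]

theorem chainPotential_le_add {z w : X} (h : dist z w ≤ ε) :
    chainPotential ε x A M w ≤ chainPotential ε x A M z + dist z w := by
  have hd := dist_nonneg (x := z) (y := w)
  rw [← ENNReal.ofReal_le_ofReal_iff (add_nonneg (chainPotential_nonneg z) hd),
    ENNReal.ofReal_add (chainPotential_nonneg z) hd, ofReal_chainPotential,
    ofReal_chainPotential, ← edist_dist]
  have h1 : (A.indicator (fun _ => (1 : ℝ≥0∞)) z + A.indicator (fun _ => 1) w) / 2 *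
      edist z w ≤ edist z w := by
    refine mul_le_of_le_one_left' (ENNReal.div_le_of_le_mul ?_)
    rw [one_mul, ← one_add_one_eq_two]
    gcongr <;> exact indicator_le_self' (fun _ _ => zero_le) _
  rw [min_add]
  exact min_le_min ((epsChainWidth_le_add A h).trans (by gcongr)) le_self_add

theorem chainPotential_le_of_notMem {z w : X} (h : dist z w ≤ ε) (hz : z ∉ A) (hw : w ∉ A) :
    chainPotential ε x A M w ≤ chainPotential ε x A M z := by
  rw [← ENNReal.ofReal_le_ofReal_iff (chainPotential_nonneg z), ofReal_chainPotential,
    ofReal_chainPotential]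
  refine min_le_min ((epsChainWidth_le_add A h).trans ?_) le_rfl
  simp [hz, hw]

/-- The factor 2 allows for steps with only one endpoint in the collar, which the chain integral
counts with weight one half. -/
theorem IsSeparatingSet.le_two_mul_chainWidth {x y : X} {Ω : Set X} (hΩ : IsSeparatingSet x y Ω) {r : ℝ}
    (hr : 0 < r) (hry : r ≤ Metric.infDist y Ω) :
    ENNReal.ofReal r ≤ 2 * chainWidth x y (Metric.thickening r Ω \ Ω) := by
  obtain ⟨hcl, hx, -⟩ := hΩ
  have hxΩ := interior_subset hx
  set A := Metric.thickening r Ω \ Ω with hA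
  suffices h : ENNReal.ofReal r ≤ 2 * epsChainWidth (r / 2) x y A from
    h.trans (by gcongr; exact le_iSup₂ (f := fun ε (_ : ε ∈ Ioi (0 : ℝ)) =>
      epsChainWidth ε x y A) (r / 2) (half_pos hr))
  simp only [epsChainWidth]
  rw [ENNReal.mul_iInf_of_ne (by simp) (by simp)]
  refine le_iInf fun c => ?_
  rw [ENNReal.mul_iInf_of_ne (by simp) (by simp)]
  refine le_iInf fun hc => ?_
  obtain ⟨hstep, h0, hlast⟩ := hc
  set h : X → ℝ := fun z => min (Metric.infDist z Ω) r with hh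
  have hhr : h (c.pt (Fin.last c.N)) - h (c.pt 0) = r := by
    rw [h0, hlast, hh]
    simp [Metric.infDist_zero_of_mem hxΩ, hry, hr.le]
  rw [← hhr]
  refine c.ofReal_sub_le_integral h _ fun i => ?_
  set p := c.pt i.castSucc
  set q := c.pt i.succ
  have hpq : dist p q ≤ r / 2 := hstep i
  have hlip : h q - h p ≤ dist p q := by
    have h1 : |h q - h p| ≤ |Metric.infDist q Ω - Metric.infDist p Ω| :=
      abs_min_sub_min_le_abs _ _ _
    have h2 : |Metric.infDist q Ω - Metric.infDist p Ω| ≤ dist q p :=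
      (Metric.lipschitz_infDist_pt Ω).dist_le_mul q p |>.trans (by simp)
    rw [dist_comm p q]
    exact (le_abs_self _).trans (h1.trans h2)
  have hthick : ∀ z, z ∈ Metric.thickening r Ω ↔ Metric.infDist z Ω < r := fun z => by
    rw [Metric.mem_thickening_iff, Metric.infDist_lt_iff ⟨x, hxΩ⟩]
  rw [← mul_assoc, ENNReal.mul_div_cancel (by simp) (by simp)]
  by_cases hmem : p ∈ A ∨ q ∈ A
  · refine (ENNReal.ofReal_le_ofReal hlip).trans ?_
    rw [← edist_dist]
    refine le_mul_of_one_le_left' ?_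
    rcases hmem with hmem | hmem <;> simp [hmem]
  · push Not at hmem
    have hcase : ∀ z, z ∉ A → z ∈ Ω ∨ r ≤ Metric.infDist z Ω := by
      intro z hz
      by_contra hcon
      push Not at hcon
      exact hz ⟨(hthick z).2 hcon.2, hcon.1⟩
    have hle : h q - h p ≤ 0 := by
      rcases hcase p hmem.1 with hp | hp
      · rcases hcase q hmem.2 with hq | hq
        · simp [hh, Metric.infDist_zero_of_mem hp, Metric.infDist_zero_of_mem hq]
        -- A step of length at most `r / 2` cannot jump over the collar.
        · have := Metric.infDist_le_dist_of_mem (x := q) hp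
          rw [dist_comm] at this
          linarith
      · have : h p = r := min_eq_right hp
        have : h q ≤ r := min_le_right _ _
        linarith
    rw [ENNReal.ofReal_of_nonpos hle]
    exact zero_le

end ChainPotential

/-! ### Flattening a function that is constant at scale `ε` on a closed set. -/

section Flattening

variable {X : Type u} [MetricSpace X]

/-- A bounded function which is `1`-Lipschitz at scale `ε`, and constant at scale `ε` on a closed
set, is uniformly close to a Lipschitz function which is locally constant near that closed set. -/
theorem exists_lipschitz_flattening {u : X → ℝ} {M ε s : ℝ} {F : Set X} (hF : IsClosed F)
    (hs : 0 < s) (hsε : 7 * s ≤ ε) (hu0 : ∀ z, 0 ≤ u z) (huM : ∀ z, u z ≤ M)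
    (hlip : ∀ z w, dist z w ≤ ε → |u z - u w| ≤ dist z w)
    (hconst : ∀ z w, z ∈ F → w ∈ F → dist z w ≤ ε → u z = u w) :
    ∃ v : X → ℝ, (∃ K : ℝ≥0, LipschitzWith K v) ∧ (∀ z, |v z - u z| ≤ 3 * s) ∧
      (∀ z, localLip v z ≤ 4) ∧ ∀ z ∈ F, localLip v z = 0 := by
  have of_local : ∀ v : X → ℝ, (∀ z, |v z - u z| ≤ 3 * s) →
      (∀ z w, dist z w < s → |v z - v w| ≤ 4 * dist z w) →
      (∃ K : ℝ≥0, LipschitzWith K v) ∧ ∀ z, localLip v z ≤ 4 := by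
    intro v hvu hloc
    constructor
    · refine ⟨(4 + (M + 6 * s) / s).toNNReal, LipschitzWith.of_dist_le_mul fun z w => ?_⟩
      have hM : 0 ≤ M := (hu0 z).trans (huM z)
      have hq : 0 ≤ (M + 6 * s) / s := by positivity
      rw [Real.coe_toNNReal _ (by positivity), Real.dist_eq]
      rcases lt_or_ge (dist z w) s with h | h
      · refine (hloc z w h).trans ?_
        gcongr
        linarith
      -- At distances at least `s`, boundedness alone gives a Lipschitz bound; its constant is
      -- irrelevant, only `localLip` matters.
      · have h1 : |v z - v w| ≤ M + 6 * s := by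
          have a := abs_le.1 (hvu z)
          have b := abs_le.1 (hvu w)
          rw [abs_le]
          constructor <;> linarith [hu0 z, hu0 w, huM z, huM w]
        calc |v z - v w| ≤ (M + 6 * s) / s * s := by rwa [div_mul_cancel₀ _ hs.ne']
          _ ≤ (4 + (M + 6 * s) / s) * dist z w := by gcongr; linarith
    · intro z
      refine localLip_le_of_forall (K := 4) hs fun w hw => ?_
      simpa [Real.dist_eq] using hloc w z hw
  rcases F.eq_empty_or_nonempty with rfl | hne
  · have h1 : ∀ z, |u z - u z| ≤ 3 * s := fun z => by simp [hs.le]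
    obtain ⟨h2, h3⟩ := of_local u h1 fun z w hzw =>
      (hlip z w (by linarith)).trans (by linarith [dist_nonneg (x := z) (y := w)])
    exact ⟨u, h2, h1, h3, by simp⟩
  have hπ : ∀ z, ∃ w ∈ F, dist z w < Metric.infDist z F + s := fun z =>
    (Metric.infDist_lt_iff hne).1 (by linarith)
  choose π hπF hπd using hπ
  set θ : X → ℝ := fun z => max 0 (min 1 (2 - Metric.infDist z F / s)) with hθ
  have hθ0 : ∀ z, 0 ≤ θ z := fun z => le_max_left _ _
  have hθ1 : ∀ z, θ z ≤ 1 := fun z => max_le zero_le_one (min_le_left _ _)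
  have hθfar : ∀ z, 2 * s ≤ Metric.infDist z F → θ z = 0 := by
    intro z hz
    have : 2 ≤ Metric.infDist z F / s := (le_div_iff₀ hs).2 hz
    exact max_eq_left ((min_le_right _ _).trans (by linarith))
  have hθnear : ∀ z, Metric.infDist z F < s → θ z = 1 := by
    intro z hz
    have : Metric.infDist z F / s < 1 := (div_lt_one hs).2 hz
    rw [hθ]
    simp only
    rw [min_eq_left (by linarith), max_eq_right zero_le_one]
  have hθlip : ∀ z w, |θ z - θ w| ≤ dist z w / s := by
    intro z w
    have h1 : |Metric.infDist z F - Metric.infDist w F| ≤ dist z w :=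
      (Metric.lipschitz_infDist_pt F).dist_le_mul z w |>.trans (by simp)
    calc |θ z - θ w| ≤ |(2 - Metric.infDist z F / s) - (2 - Metric.infDist w F / s)| := by
          simp only [hθ, max_comm (0 : ℝ), min_comm (1 : ℝ)]
          exact (abs_max_sub_max_le_abs _ _ _).trans (abs_min_sub_min_le_abs _ _ _)
      _ = |Metric.infDist z F - Metric.infDist w F| / s := by
          rw [← abs_of_pos hs, ← abs_div, abs_of_pos hs, abs_sub_comm]; congr 1; ring
      _ ≤ dist z w / s := by gcongr
  have hπu : ∀ z, Metric.infDist z F < 2 * s → |u (π z) - u z| ≤ 3 * s := by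
    intro z hz
    have := hπd z
    rw [abs_sub_comm]
    exact (hlip z (π z) (by linarith)).trans (by linarith)
  have hππ : ∀ z w, dist z w < s → Metric.infDist z F < 2 * s → Metric.infDist w F < 2 * s →
      u (π z) = u (π w) := by
    intro z w hzw hz hw
    -- The two near-projections are within `3 * s + s + 3 * s = 7 * s ≤ ε` of each other.
    refine hconst _ _ (hπF z) (hπF w) ?_
    have h1 := dist_triangle4 (π z) z w (π w)
    rw [dist_comm (π z) z] at h1
    linarith [hπd z, hπd w]
  -- The choice `π` need not be continuous, but by `hππ` the function `u ∘ π` is constant at scale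
  -- `s` near `F`.
  set v : X → ℝ := fun z => u z + θ z * (u (π z) - u z) with hv
  have hvu : ∀ z, |v z - u z| ≤ 3 * s := by
    intro z
    rcases lt_or_ge (Metric.infDist z F) (2 * s) with h | h
    · have : |v z - u z| = θ z * |u (π z) - u z| := by
        rw [hv]; simp only [add_sub_cancel_left, abs_mul, abs_of_nonneg (hθ0 z)]
      rw [this]
      exact (mul_le_of_le_one_left (abs_nonneg _) (hθ1 z)).trans (hπu z h)
    · simp [hv, hθfar z h, hs.le]
  have hloc : ∀ z w, dist z w < s → |v z - v w| ≤ 4 * dist z w := by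
    intro z w hzw
    have hd := hlip z w (by linarith)
    -- One value `p` serves both points: the projected values agree if both are near `F`, and `θ`
    -- vanishes at a point that is not. The bound 4 is then 1 from `u` plus `3 * s / s` from the
    -- cutoff.
    obtain ⟨p, hpz, hpw, hp⟩ : ∃ p, v z = u z + θ z * (p - u z) ∧
        v w = u w + θ w * (p - u w) ∧ (|p - u z| ≤ 3 * s ∨ |p - u w| ≤ 3 * s) := by
      rcases lt_or_ge (Metric.infDist z F) (2 * s) with h | h <;>
        rcases lt_or_ge (Metric.infDist w F) (2 * s) with h' | h'
      · exact ⟨u (π z), rfl, by rw [hππ z w hzw h h'], Or.inl (hπu z h)⟩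
      · exact ⟨u (π z), rfl, by simp [hv, hθfar w h'], Or.inl (hπu z h)⟩
      · exact ⟨u (π w), by simp [hv, hθfar z h], rfl, Or.inr (hπu w h')⟩
      · exact ⟨u z, by simp [hv, hθfar z h], by simp [hv, hθfar w h'], Or.inl (by simp [hs.le])⟩
    have key : ∀ (t a : ℝ), 0 ≤ t → t ≤ 1 → |a| ≤ 3 * s →
        |(1 - t) * (u z - u w) + (θ z - θ w) * a| ≤ 4 * dist z w := by
      intro t a ht0 ht1 ha
      have h1 : |(1 - t) * (u z - u w)| ≤ dist z w := by
        rw [abs_mul, abs_of_nonneg (by linarith : 0 ≤ 1 - t)]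
        exact (mul_le_of_le_one_left (abs_nonneg _) (by linarith)).trans hd
      have h2 : |(θ z - θ w) * a| ≤ 3 * dist z w := by
        rw [abs_mul]
        calc |θ z - θ w| * |a| ≤ dist z w / s * (3 * s) := by gcongr; exact hθlip z w
          _ = 3 * dist z w := by field_simp
      exact (abs_add_le _ _).trans (by linarith)
    rw [hpz, hpw]
    rcases hp with hp | hp
    · convert key (θ w) _ (hθ0 w) (hθ1 w) hp using 2; ring
    · convert key (θ z) _ (hθ0 z) (hθ1 z) hp using 2; ring
  obtain ⟨h2, h3⟩ := of_local v hvu hloc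
  refine ⟨v, h2, hvu, h3, fun z hz => le_antisymm ?_ zero_le⟩
  refine localLip_le_of_forall (K := 0) hs fun w hw => ?_
  have hz0 : Metric.infDist z F = 0 := Metric.infDist_zero_of_mem hz
  have hwd : Metric.infDist w F < s := (Metric.infDist_le_dist_of_mem hz).trans_lt hw
  have h4 := hππ w z hw (by linarith) (by linarith)
  simp [hv, hθnear w hwd, hθnear z (by linarith), h4]

end Flattening

/-! ### From the Poincaré estimate to chain width, and on to Minkowski content. -/

section Implications

variable {X : Type u} [MetricSpace X] [MeasurableSpace X] {m : Measure X} {C_D C L : ℝ} {x y : X}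

theorem PointwisePoincare.epsChainWidth_le_of_isOpen [BorelSpace X]
    (hP : PointwisePoincare X m x y C L) {U : Set X} (hU : IsOpen U) {ε : ℝ} (hε : 0 < ε) :
    epsChainWidth ε x y U ≤ ENNReal.ofReal C * (4 * rieszMeasure m L x y U) := by
  -- The width may be infinite, so it is tested against finite heights `M`, at which the potential
  -- is truncated.
  refine ENNReal.le_of_forall_nnreal_lt fun M hM => ?_
  refine ENNReal.le_of_forall_pos_le_add fun δ hδ _ => ?_
  -- Flattening requires `7 * s ≤ ε` and costs `3 * s` at each of the two poles.
  set s : ℝ := min (ε / 7) (δ / 6) with hs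
  have hδ' : (0 : ℝ) < δ := hδ
  have hspos : 0 < s := by positivity
  have hs1 : 7 * s ≤ ε := by linarith [min_le_left (ε / 7) ((δ : ℝ) / 6)]
  have hs2 : 6 * s ≤ δ := by linarith [min_le_right (ε / 7) ((δ : ℝ) / 6)]
  obtain ⟨v, hvK, hvu, hv4, hv0⟩ := exists_lipschitz_flattening (u := chainPotential ε x U M)
    (M := M) (ε := ε) (s := s) hU.isClosed_compl hspos hs1 chainPotential_nonneg
    chainPotential_le
    (fun z w h => by
      rw [abs_le]
      have h1 := chainPotential_le_add (x := x) (A := U) (M := M) h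
      have h2 := chainPotential_le_add (x := x) (A := U) (M := M) ((dist_comm w z).trans_le h)
      rw [dist_comm w z] at h2
      constructor <;> linarith)
    (fun z w hz hw h => le_antisymm
      (chainPotential_le_of_notMem ((dist_comm w z).trans_le h) hw hz)
      (chainPotential_le_of_notMem h hz hw))
  have hint : ∫⁻ z, localLip v z ∂(rieszMeasure m L x y) ≤ 4 * rieszMeasure m L x y U := by
    rw [← lintegral_indicator_const hU.measurableSet]
    refine lintegral_mono fun z => ?_
    by_cases hz : z ∈ U
    · simpa [hz] using hv4 z
    · simpa [hz] using hv0 z hz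
  have hreal : chainPotential ε x U M y ≤ |v x - v y| + δ := by
    have h1 := abs_le.1 (hvu x)
    have h2 := abs_le.1 (hvu y)
    rw [chainPotential_self] at h1
    linarith [neg_abs_le (v x - v y)]
  calc (M : ℝ≥0∞) = ENNReal.ofReal (chainPotential ε x U M y) := by
        rw [ofReal_chainPotential, min_eq_right hM.le]
    _ ≤ ENNReal.ofReal |v x - v y| + δ := by
        refine (ENNReal.ofReal_le_ofReal hreal).trans_eq ?_
        rw [ENNReal.ofReal_add (abs_nonneg _) δ.coe_nonneg, ENNReal.ofReal_coe_nnreal]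
    _ ≤ ENNReal.ofReal C * (4 * rieszMeasure m L x y U) + δ := by
        gcongr
        exact (hP v hvK).trans (by gcongr)

theorem PointwisePoincare.chainWidthBound (hm : IsDoublingMMS m C_D) (hC : 0 < C)
    (hP : PointwisePoincare X m x y C L) : ChainWidthBound X m x y (4 * C) L := by
  have := hm.borel
  have := hm.isFiniteMeasure_rieszMeasure L x y
  intro A
  refine iSup₂_le fun ε hε => ?_
  rw [A.measure_eq_iInf_isOpen, ENNReal.mul_iInf_of_ne (by simpa using hC) ENNReal.ofReal_ne_top]
  refine le_iInf fun U => ?_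
  by_cases hAU : A ⊆ U
  swap
  · simp [hAU, hC]
  by_cases hU : IsOpen U
  swap
  · simp [hU, hC]
  simp only [hAU, hU, iInf_pos]
  refine (epsChainWidth_mono ε x y hAU).trans ((hP.epsChainWidth_le_of_isOpen hU hε).trans_eq ?_)
  rw [mul_comm 4 C, ENNReal.ofReal_mul hC.le, mul_assoc]
  simp

theorem ChainWidthBound.bigMinkowskiContent (hC : 0 < C) (hW : ChainWidthBound X m x y C L) :
    BigMinkowskiContent X m x y (1 / (2 * C)) L := by
  intro Ω hΩ
  have hxΩ := interior_subset hΩ.2.1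
  have hpos : 0 < Metric.infDist y Ω :=
    (hΩ.1.notMem_iff_infDist_pos ⟨x, hxΩ⟩).1 hΩ.2.2
  refine le_liminf_of_le (by isBoundedDefault) ?_
  filter_upwards [Ioc_mem_nhdsGT hpos] with r hr
  have h1 := (hΩ.le_two_mul_chainWidth hr.1 hr.2).trans (mul_le_mul_right (hW _) 2)
  have hr0 : ENNReal.ofReal r ≠ 0 := by simpa using hr.1
  rw [ENNReal.le_div_iff_mul_le (Or.inl hr0) (Or.inl ENNReal.ofReal_ne_top),
    ENNReal.ofReal_div_of_pos (by positivity), ENNReal.ofReal_one, one_div, mul_comm,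
    ← div_eq_mul_inv]
  refine ENNReal.div_le_of_le_mul ?_
  rw [ENNReal.ofReal_mul zero_le_two, ENNReal.ofReal_ofNat, mul_comm, mul_assoc]
  exact h1

end Implications

/-! ### Coarea inequality for Minkowski contents. -/

section Coarea

variable {X : Type u} [MetricSpace X] [MeasurableSpace X] [BorelSpace X]

/-- The coarea inequality for the Minkowski contents of the sublevel sets, at fixed scale. -/
theorem lintegral_measure_thickening_sublevel_le (ν : Measure X) [IsFiniteMeasure ν] {f : X → ℝ}
    {K : ℝ≥0} (hf : LipschitzWith K f) {r : ℝ} (hr : 0 < r) :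
    ∃ G : ℝ → ℝ≥0∞, Measurable G ∧
      (∀ t, ν (Metric.thickening r {z | f z ≤ t} \ {z | f z ≤ t}) / ENNReal.ofReal r ≤ G t) ∧
      ∫⁻ t, G t ≤ ∫⁻ z, slopeAt r f z ∂ν := by
  have hslope : Measurable (slopeAt r f) := (lowerSemicontinuous_slopeAt hf.continuous r).measurable
  have hfin : ∀ z, slopeAt r f z ≠ ∞ := fun z =>
    ((slopeAt_le_of_forall fun w _ => hf.dist_le_mul w z).trans_lt ENNReal.coe_lt_top).ne
  set g : X → ℝ := fun z => f z - (slopeAt r f z).toReal * r with hg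
  have hgm : Measurable g := hf.continuous.measurable.sub (hslope.ennreal_toReal.mul_const r)
  -- If `z` lies in the `r`-collar of `{f ≤ t}`, then `t` lies within `r * slopeAt r f z` below `f
  -- z`. `E` encodes this as a jointly measurable set, so Fubini applies.
  set E : Set (X × ℝ) := {p | g p.1 ≤ p.2} ∩ {p | p.2 < f p.1} with hE
  have hEm : MeasurableSet E :=
    (measurableSet_le (hgm.comp measurable_fst) measurable_snd).inter
      (measurableSet_lt measurable_snd (hf.continuous.measurable.comp measurable_fst))
  have hr0 : ENNReal.ofReal r ≠ 0 := by simpa using hr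
  refine ⟨fun t => ν ((fun z => (z, t)) ⁻¹' E) / ENNReal.ofReal r,
    (measurable_measure_prodMk_right hEm).div_const _, fun t => ?_, ?_⟩
  · refine ENNReal.div_le_div_right (measure_mono ?_) _
    rintro z ⟨hz1, hz2⟩
    obtain ⟨w, hw, hwz⟩ := Metric.mem_thickening_iff.1 hz1
    change f w ≤ t at hw
    replace hz2 : t < f z := not_le.1 hz2
    refine ⟨?_, hz2⟩
    have h1 := dist_le_slopeAt_mul (f := f) ((dist_comm w z).trans_lt hwz)
    have h2 := ENNReal.toReal_mono (ENNReal.mul_ne_top (hfin z) (edist_ne_top _ _)) h1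
    rw [ENNReal.toReal_mul, ← dist_edist, ← dist_edist, Real.dist_eq, dist_comm] at h2
    have h3 : (slopeAt r f z).toReal * dist z w ≤ (slopeAt r f z).toReal * r := by
      gcongr
    change f z - (slopeAt r f z).toReal * r ≤ t
    linarith [neg_abs_le (f w - f z)]
  · have hswap : ∫⁻ t : ℝ, ν ((fun z => (z, t)) ⁻¹' E) =
        ∫⁻ z, volume (Prod.mk z ⁻¹' E) ∂ν := by
      rw [← Measure.prod_apply hEm, ← Measure.prod_apply_symm hEm]
    simp only [div_eq_mul_inv]
    rw [lintegral_mul_const _ (measurable_measure_prodMk_right hEm), hswap,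
      ← lintegral_mul_const _ (measurable_measure_prodMk_left hEm)]
    refine lintegral_mono fun z => ?_
    have hsec : Prod.mk z ⁻¹' E = Ico (g z) (f z) := rfl
    rw [hsec, Real.volume_Ico, ← div_eq_mul_inv]
    refine ENNReal.div_le_of_le_mul (le_of_eq ?_)
    rw [hg, sub_sub_cancel, ENNReal.ofReal_mul ENNReal.toReal_nonneg,
      ENNReal.ofReal_toReal (hfin z)]

/-- The coarea inequality for the lower Minkowski contents of the sublevel sets of a Lipschitz
function. -/
theorem lintegral_le_lintegral_localLip (ν : Measure X) [IsFiniteMeasure ν] {f : X → ℝ}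
    {K : ℝ≥0} (hf : LipschitzWith K f) {a b : ℝ} {c : ℝ≥0∞}
    (hc : ∀ t ∈ Ioo a b, c ≤ minkowskiContent ν {z | f z ≤ t}) :
    c * ENNReal.ofReal (b - a) ≤ ∫⁻ z, localLip f z ∂ν := by
  set r : ℕ → ℝ := fun n => 1 / ((n : ℝ) + 1) with hr
  have hrpos : ∀ n, 0 < r n := fun n => by positivity
  have hr0 : Tendsto r atTop (𝓝[>] 0) :=
    tendsto_nhdsWithin_iff.2 ⟨tendsto_one_div_add_atTop_nhds_zero_nat,
      Eventually.of_forall hrpos⟩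
  choose G hGm hGle hGint using fun n => lintegral_measure_thickening_sublevel_le ν hf (hrpos n)
  have hlim : Tendsto (fun n => ∫⁻ z, slopeAt (r n) f z ∂ν) atTop
      (𝓝 (∫⁻ z, localLip f z ∂ν)) := by
    refine tendsto_lintegral_of_dominated_convergence (fun _ => (K : ℝ≥0∞))
      (fun n => (lowerSemicontinuous_slopeAt hf.continuous _).measurable)
      (fun n => Eventually.of_forall fun z =>
        slopeAt_le_of_forall fun w _ => hf.dist_le_mul w z) ?_
      (Eventually.of_forall fun z => (tendsto_slopeAt f z).comp hr0)
    rw [lintegral_const]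
    exact ENNReal.mul_ne_top ENNReal.coe_ne_top (measure_ne_top _ _)
  calc c * ENNReal.ofReal (b - a) = ∫⁻ _ in Ioo a b, c := by
        rw [setLIntegral_const, Real.volume_Ioo]
    _ ≤ ∫⁻ t in Ioo a b, liminf (fun n => G n t) atTop := by
        refine setLIntegral_mono' measurableSet_Ioo fun t ht => (hc t ht).trans ?_
        calc minkowskiContent ν {z | f z ≤ t}
            ≤ liminf (fun n => ν (Metric.thickening (r n) {z | f z ≤ t} \ {z | f z ≤ t}) /
                ENNReal.ofReal (r n)) atTop := by
              rw [minkowskiContent]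
              exact hr0.liminf_le_liminf_comp
          _ ≤ liminf (fun n => G n t) atTop :=
              liminf_le_liminf (Eventually.of_forall fun n => hGle n t)
    _ ≤ liminf (fun n => ∫⁻ t in Ioo a b, G n t) atTop := lintegral_liminf_le hGm
    _ ≤ liminf (fun n => ∫⁻ z, slopeAt (r n) f z ∂ν) atTop :=
        liminf_le_liminf (Eventually.of_forall fun n =>
          (setLIntegral_le_lintegral _ _).trans (hGint n))
    _ = ∫⁻ z, localLip f z ∂ν := hlim.liminf_eq

end Coarea

/-! ### From Minkowski content to the Poincaré estimate, and closing the cycle. -/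

section Equivalences

theorem isSeparatingSet_sublevel {X : Type u} [MetricSpace X] {f : X → ℝ} (hf : Continuous f)
    {x y : X} {t : ℝ} (hx : f x < t) (hy : t < f y) : IsSeparatingSet x y {z | f z ≤ t} :=
  ⟨isClosed_le hf continuous_const,
    interior_maximal (fun _ hz => le_of_lt hz) (isOpen_lt hf continuous_const) hx,
    not_le.2 hy⟩

/-- Sublevel sets of `f` separate `x` from `y` only when `f x < f y`; the opposite case passes to
`-f`. -/
theorem localLip_neg {X : Type u} [MetricSpace X] (f : X → ℝ) :
    localLip (fun z => -f z) = localLip f := by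
  funext z
  simp only [localLip, slopeAt, edist_neg_neg]

theorem BigMinkowskiContent.pointwisePoincare {X : Type u} [MetricSpace X] [MeasurableSpace X]
    {m : Measure X} {C_D c L : ℝ} {x y : X} (hm : IsDoublingMMS m C_D) (hc : 0 < c)
    (hB : BigMinkowskiContent X m x y c L) : PointwisePoincare X m x y (1 / c) L := by
  have := hm.borel
  have := hm.isFiniteMeasure_rieszMeasure L x y
  have main : ∀ f : X → ℝ, (∃ K : ℝ≥0, LipschitzWith K f) → ENNReal.ofReal (f y - f x) ≤
      ENNReal.ofReal (1 / c) * ∫⁻ z, localLip f z ∂(rieszMeasure m L x y) := by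
    rintro f ⟨K, hf⟩
    have h := lintegral_le_lintegral_localLip (rieszMeasure m L x y) hf (a := f x) (b := f y)
      fun t ht => hB _ (isSeparatingSet_sublevel hf.continuous ht.1 ht.2)
    calc ENNReal.ofReal (f y - f x)
        = ENNReal.ofReal (1 / c) * (ENNReal.ofReal c * ENNReal.ofReal (f y - f x)) := by
          rw [← mul_assoc, ← ENNReal.ofReal_mul (by positivity), one_div_mul_cancel hc.ne',
            ENNReal.ofReal_one, one_mul]
      _ ≤ _ := by gcongr
  rintro f ⟨K, hf⟩
  rcases le_total (f x) (f y) with h | h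
  · rw [abs_sub_comm, abs_of_nonneg (sub_nonneg.2 h)]
    exact main f ⟨K, hf⟩
  · rw [abs_of_nonneg (sub_nonneg.2 h)]
    have := main (fun z => -f z) ⟨K, hf.neg⟩
    rw [localLip_neg] at this
    rwa [neg_sub_neg] at this

theorem QuantImplies.trans {P Q R : TwoPointCondition.{u}} (h₁ : QuantImplies P Q)
    (h₂ : QuantImplies Q R) : QuantImplies P R := by
  intro C_D C L hD hC hL
  obtain ⟨C', L', hC', hL', h⟩ := h₁ C_D C L hD hC hL
  obtain ⟨C'', L'', hC'', hL'', h'⟩ := h₂ C_D C' L' hD hC' hL'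
  exact ⟨C'', L'', hC'', hL'', fun X _ _ m hm x y hP => h' X m hm x y (h X m hm x y hP)⟩

theorem quantImplies_pointwisePoincare_chainWidthBound :
    QuantImplies PointwisePoincare.{u} ChainWidthBound.{u} := fun _ C L _ hC hL =>
  ⟨4 * C, L, by positivity, hL, fun _ _ _ _ hm _ _ hP => PointwisePoincare.chainWidthBound hm hC hP⟩

theorem quantImplies_chainWidthBound_bigMinkowskiContent :
    QuantImplies ChainWidthBound.{u} BigMinkowskiContent.{u} := fun _ C L _ hC hL =>
  ⟨1 / (2 * C), L, by positivity, hL, fun _ _ _ _ _ _ _ hW =>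
    ChainWidthBound.bigMinkowskiContent hC hW⟩

theorem quantImplies_bigMinkowskiContent_pointwisePoincare :
    QuantImplies BigMinkowskiContent.{u} PointwisePoincare.{u} := fun _ c L _ hc hL =>
  ⟨1 / c, L, by positivity, hL, fun _ _ _ _ hm _ _ hB =>
    BigMinkowskiContent.pointwisePoincare hm hc hB⟩

end Equivalences

theorem mainTheorem8 :
    QuantEquiv PointwisePoincare.{u} ChainWidthBound.{u} ∧
    QuantEquiv ChainWidthBound.{u} BigMinkowskiContent.{u} ∧
    QuantEquiv PointwisePoincare.{u} BigMinkowskiContent.{u} := by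
  have h₁ := quantImplies_pointwisePoincare_chainWidthBound.{u}
  have h₂ := quantImplies_chainWidthBound_bigMinkowskiContent.{u}
  have h₃ := quantImplies_bigMinkowskiContent_pointwisePoincare.{u}
  exact ⟨⟨h₁, h₂.trans h₃⟩, ⟨h₂, h₃.trans h₁⟩, ⟨h₁.trans h₂, h₃⟩⟩
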